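/- Let $k$ be a field, $V$ a $k$-vector space, $\mathcal B$ a family of subspaces of $V$ and $V^+\in\mathcal B$, such that: (1) $A+B,\ A\cap B\in\mathcal B$ for $A,B\in\mathcal B$; (2) $\dim (A+B)/(A\cap B)<\infty$ for $A,B\in\mathcal B$; (3) $\bigcap_{A\in\mathcal B}A=0$; (4) $V\to\varprojlim_{A\in\mathcal B}V/A$ is surjective; (5) $\varinjlim_{A\in\mathcal B}A\to V/B$ is surjective for every $B\in\mathcal B$. A subspace of $V$ which contains a member of $\mathcal B$ with finite codimension is called a neighbourhood, and $\mathcal B_0$ denotes the set of neighbourhoods $A$ with $\dim A/(A\cap V^+)=\dim V^+/(A\cap V^+)$. The rational points of $\mathrm{Gr}(V)$ are the subspaces $L\subseteq V$ for which $L\cap V^+$ and $V/(L+V^+)$ are finite-dimensional of the same dimension. Let $D_L$ be the (one-dimensional) dual of the determinant line of the complex $L\to V/V^+$. For $A\in\mathcal B_0$, a generator of the line $\bigwedge^{\max}(A/A\cap V^+)\otimes\bigwedge^{\max}(V^+/A\cap V^+)^*$ and the determinant of $L\to V/A$ define a section $\Omega_A$, $L\mapsto\Omega_A(L)\in D_L$,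 which is unique up to a nonzero scalar and does not vanish at $L$ if and only if $L\oplus A=V$. Let $\Omega$ be the $k$-vector space spanned by the sections $\Omega_A$, $A\in\mathcal B_0$. The Plücker map sends $L$ to the rational point of $\mathbb P\Omega^*=\operatorname{Proj}(S^\bullet\Omega)$ given by the one-dimensional quotient $\Omega\to D_L$, i.e. to the line of $\Omega^*$ dual to it. Let $L_1,L_2,L_3$ be three distinct rational points of $\mathrm{Gr}(V)$. Their images under the Plücker map lie in a line of $\mathbb P\Omega^*$ if and only if $$L_1\cap L_2\subseteq L_3\subseteq L_1+L_2$$ and both inclusions are of codimension $1$. -/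

import Mathlib

namespace InfGrass

noncomputable section

/-! ### Determinants of operators that differ from the identity by an operator of finite rank -/

section FredholmDet

variable {k M : Type*} [Field k] [AddCommGroup M] [Module k M]

theorem mapsTo_range_sub_one (T : M →ₗ[k] M) :
    ∀ x ∈ LinearMap.range (T - 1), T x ∈ LinearMap.range (T - 1) := by
  rintro _ ⟨y, rfl⟩
  exact ⟨T y, by simp⟩

/-- The determinant of `T = 1 + F` with `F` of finite rank: the determinant of `T` on the
finite-dimensional `T`-stable subspace `range (T - 1)`; `T` is the identity on the quotient. -/
def fdet (T : M →ₗ[k] M) : k :=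
  LinearMap.det (T.restrict (mapsTo_range_sub_one T))

/-- The same determinant can be computed on every larger finite-dimensional subspace. -/
theorem det_restrict_eq_fdet (T : M →ₗ[k] M) (U : Submodule k M) [FiniteDimensional k U]
    (h : LinearMap.range (T - 1) ≤ U) (hU : ∀ x ∈ U, T x ∈ U) :
    LinearMap.det (T.restrict hU) = fdet T := by
  set W : Submodule k U := (LinearMap.range (T - 1)).submoduleOf U with hW
  have hWs : W ≤ W.comap (T.restrict hU) := by
    intro x hx
    exact mapsTo_range_sub_one T x.1 hx
  rw [LinearMap.det_eq_det_mul_det W (T.restrict hU) hWs]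
  have h1 : W.mapQ W (T.restrict hU) hWs = LinearMap.id := by
    ext x
    simp only [LinearMap.comp_apply, Submodule.mkQ_apply, Submodule.mapQ_apply, LinearMap.id_apply]
    rw [Submodule.Quotient.eq]
    exact ⟨x.1, by simp⟩
  rw [h1, LinearMap.det_id, mul_one]
  let e : W ≃ₗ[k] LinearMap.range (T - 1) := Submodule.submoduleOfEquivOfLe h
  rw [← LinearMap.det_conj _ e]
  unfold fdet
  congr 1

theorem fdet_one : fdet (1 : M →ₗ[k] M) = 1 := by
  have := det_restrict_eq_fdet (1 : M →ₗ[k] M) ⊥ (by simp) (by simp)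
  rw [← this]
  exact LinearMap.det_eq_one_of_subsingleton _

theorem range_mul_sub_one_le (S T : M →ₗ[k] M) : LinearMap.range (S * T - 1) ≤
    LinearMap.range (S - 1) ⊔ LinearMap.range (T - 1) := by
  rintro _ ⟨y, rfl⟩
  have : (S * T - 1) y = (S - 1) (T y) + (T - 1) y := by simp
  rw [this]
  exact Submodule.add_mem_sup ⟨_, rfl⟩ ⟨_, rfl⟩

theorem fdet_mul (S T : M →ₗ[k] M) [FiniteDimensional k (LinearMap.range (S - 1))]
    [FiniteDimensional k (LinearMap.range (T - 1))] : fdet (S * T) = fdet S * fdet T := by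
  set U := LinearMap.range (S - 1) ⊔ LinearMap.range (T - 1) with hU
  have key : ∀ R : M →ₗ[k] M, LinearMap.range (R - 1) ≤ U → ∀ x ∈ U, R x ∈ U := by
    intro R hR x hx
    have : R x = (R - 1) x + x := by simp
    rw [this]
    exact U.add_mem (hR ⟨x, rfl⟩) hx
  have hS := key S le_sup_left
  have hT := key T le_sup_right
  have hST := key (S * T) (range_mul_sub_one_le S T)
  rw [← det_restrict_eq_fdet S U le_sup_left hS, ← det_restrict_eq_fdet T U le_sup_right hT,
    ← det_restrict_eq_fdet (S * T) U (range_mul_sub_one_le S T) hST, ← LinearMap.det_comp]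
  rfl

end FredholmDet

/-! ### Subspaces that are finite-dimensional relative to another one -/

section Relative

variable {k V : Type*} [Field k] [AddCommGroup V] [Module k V]

/-- The quotient `Q / (P ∩ Q)`; for `P ≤ Q` this is `Q / P`. -/
abbrev RelQuot (P Q : Submodule k V) : Type _ := Q ⧸ P.submoduleOf Q

theorem finite_relQuot_iff (P Q : Submodule k V) : FiniteDimensional k (RelQuot P Q) ↔
    ∃ F : Submodule k V, FiniteDimensional k F ∧ Q ≤ P ⊔ F := by
  constructor
  · intro h
    obtain ⟨C, hC⟩ := Submodule.exists_isCompl (P.submoduleOf Q)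
    have : FiniteDimensional k C :=
      LinearEquiv.finiteDimensional (Submodule.quotientEquivOfIsCompl _ _ hC)
    refine ⟨C.map Q.subtype, inferInstance, fun x hx => ?_⟩
    have hx' : (⟨x, hx⟩ : Q) ∈ P.submoduleOf Q ⊔ C := by rw [hC.sup_eq_top]; trivial
    obtain ⟨y, hy, z, hz, hyz⟩ := Submodule.mem_sup.1 hx'
    exact Submodule.mem_sup.2 ⟨y, hy, z, ⟨z, hz, rfl⟩, congrArg Subtype.val hyz⟩
  · rintro ⟨F, hF, hQ⟩
    have hle : Q.map P.mkQ ≤ F.map P.mkQ := by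
      refine (Submodule.map_mono hQ).trans ?_
      rw [Submodule.map_sup]
      simp
    have : FiniteDimensional k (Q.map P.mkQ) := Submodule.finiteDimensional_of_le hle
    have hk : P.submoduleOf Q = LinearMap.ker (P.mkQ.comp Q.subtype) := by
      ext x; simp [Submodule.submoduleOf]
    have hr : LinearMap.range (P.mkQ.comp Q.subtype) = Q.map P.mkQ := by
      rw [LinearMap.range_comp, Submodule.range_subtype]
    have : FiniteDimensional k (LinearMap.range (P.mkQ.comp Q.subtype)) := by rwa [hr]
    exact LinearEquiv.finiteDimensional ((Submodule.quotEquivOfEq _ _ hk) ≪≫ₗ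
      (LinearMap.quotKerEquivRange _)).symm

/-- A linear map with kernel and cokernel of the same finite dimension is inverted, up to an
operator of finite rank, by a linear isomorphism. -/
theorem exists_equiv_of_index_zero {M N : Type*} [AddCommGroup M] [Module k M] [AddCommGroup N]
    [Module k N] (f : M →ₗ[k] N) [FiniteDimensional k (LinearMap.ker f)]
    [FiniteDimensional k (N ⧸ LinearMap.range f)]
    (h : Module.finrank k (LinearMap.ker f) = Module.finrank k (N ⧸ LinearMap.range f)) :
    ∃ w : N ≃ₗ[k] M, FiniteDimensional k (LinearMap.range (f ∘ₗ w.toLinearMap - 1)) := by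
  obtain ⟨C, hC⟩ := Submodule.exists_isCompl (LinearMap.ker f)
  obtain ⟨R, hR⟩ := Submodule.exists_isCompl (LinearMap.range f)
  let q := Submodule.quotientEquivOfIsCompl _ _ hR
  have : FiniteDimensional k R := LinearEquiv.finiteDimensional q
  have hfr : Module.finrank k (LinearMap.ker f) = Module.finrank k R := by
    rw [h, q.finrank_eq]
  let e : LinearMap.ker f ≃ₗ[k] R := LinearEquiv.ofFinrankEq _ _ hfr
  let g : C ≃ₗ[k] LinearMap.range f := f.kerComplementEquivRange hC.symm
  let w : N ≃ₗ[k] M := (Submodule.prodEquivOfIsCompl _ _ hR).symm ≪≫ₗ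
    (g.symm.prodCongr e.symm) ≪≫ₗ (Submodule.prodEquivOfIsCompl _ _ hC.symm)
  refine ⟨w, ?_⟩
  have hle : LinearMap.range (f ∘ₗ w.toLinearMap - 1) ≤ R := by
    rintro _ ⟨y, rfl⟩
    obtain ⟨⟨a, b⟩, rfl⟩ := (Submodule.prodEquivOfIsCompl _ _ hR).surjective y
    have hg : f (g.symm a : M) = a := by
      have := congrArg Subtype.val (g.apply_symm_apply a)
      simpa [g] using this
    have he : f (e.symm b : M) = 0 := (e.symm b).2
    have : (f ∘ₗ w.toLinearMap - 1) ((Submodule.prodEquivOfIsCompl _ _ hR) (a, b)) = -(b : N) := by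
      simp [w, hg, he]
    rw [this]
    exact R.neg_mem b.2
  exact Submodule.finiteDimensional_of_le hle

end Relative

/-! ### The pair `(V, 𝓑)` and the subspace `V⁺` -/

/-- A family `𝓑` of neighbourhoods of `0` in a `k`-vector space `V`, with a distinguished
member `V⁺`. -/
structure GrassData (k V : Type*) [Field k] [AddCommGroup V] [Module k V] where
  /-- the family `𝓑` -/
  nhd : Set (Submodule k V)
  /-- the subspace `V⁺` -/
  plus : Submodule k V
  plus_mem : plus ∈ nhd
  sup_mem : ∀ A ∈ nhd, ∀ B ∈ nhd, A ⊔ B ∈ nhd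
  inf_mem : ∀ A ∈ nhd, ∀ B ∈ nhd, A ⊓ B ∈ nhd
  /-- any two members are commensurable -/
  commensurable : ∀ A ∈ nhd, ∀ B ∈ nhd, FiniteDimensional k (RelQuot (A ⊓ B) (A ⊔ B))
  /-- the topology is separated -/
  separated : sInf nhd = ⊥
  /-- `V` is complete: `V` maps onto the inverse limit of the `V / A`, `A ∈ 𝓑` -/
  complete : ∀ x : (A : nhd) → V ⧸ (A : Submodule k V),
    (∀ (A B : nhd) (h : (A : Submodule k V) ≤ B), Submodule.factor h (x A) = x B) →
      ∃ v : V, ∀ A : nhd, Submodule.Quotient.mk v = x A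
  /-- the direct limit (that is, the union) of the `A ∈ 𝓑` maps onto `V / B` for `B ∈ 𝓑` -/
  exhaustive : ∀ B ∈ nhd, ∀ x : V ⧸ B, ∃ A ∈ nhd, ∃ a ∈ A, Submodule.Quotient.mk a = x

namespace GrassData

variable {k V : Type*} [Field k] [AddCommGroup V] [Module k V] (D : GrassData k V)

/-- The subspaces that belong to `𝓑` in the wide sense: those that contain a member of `𝓑` as a
subspace of finite codimension. (The preimages in `V` of the finite-dimensional subspaces of the
quotients `V / B`, `B ∈ 𝓑`. If these are all in `𝓑`, as for `V = k((z))`, this is `𝓑` itself.) -/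
def nhdSat : Set (Submodule k V) :=
  {A | ∃ B ∈ D.nhd, B ≤ A ∧ FiniteDimensional k (RelQuot B A)}

/-- The set `𝓑₀` of the neighbourhoods `A` with `dim A / (A ∩ V⁺) = dim V⁺ / (A ∩ V⁺)`. -/
def nhdZero : Set (Submodule k V) :=
  {A | A ∈ D.nhdSat ∧ Module.finrank k (RelQuot (A ⊓ D.plus) A) =
    Module.finrank k (RelQuot (A ⊓ D.plus) D.plus)}

/-- The rational points of the Grassmannian of all indices. -/
def GrBullet : Set (Submodule k V) :=
  {L | FiniteDimensional k ↥(L ⊓ D.plus) ∧ FiniteDimensional k (V ⧸ (L ⊔ D.plus))}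

/-- The index function on rational points. -/
def index (L : Submodule k V) : ℤ :=
  (Module.finrank k ↥(L ⊓ D.plus) : ℤ) - Module.finrank k (V ⧸ (L ⊔ D.plus))

/-- The rational points of the Grassmannian `Gr(V)`: the points of index `0`. -/
def Gr : Set (Submodule k V) := {L | L ∈ D.GrBullet ∧ D.index L = 0}

/-! ### The dual determinant bundle -/

/-- The map `L → V / A` whose determinant is taken. -/
def proj (A L : Submodule k V) : L →ₗ[k] V ⧸ A := A.mkQ ∘ₗ L.subtype

/-- Frames of the determinant of the complex `L → V / V⁺`: isomorphisms `w : V / V⁺ ≃ L` whose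
composite with the projection `L → V / V⁺` differs from the identity by an operator of finite
rank. The determinant of the complex is the line generated by the frames, where two frames
`w`, `w'` are related by `w' = fdet (w⁻¹ w') • w`. -/
def Frame (L : Submodule k V) : Type _ :=
  {w : (V ⧸ D.plus) ≃ₗ[k] L //
    FiniteDimensional k (LinearMap.range (proj D.plus L ∘ₗ w.toLinearMap - 1))}

/-- The operator `w⁻¹ w'` that compares two frames. -/
def Frame.compare {D : GrassData k V} {L : Submodule k V} (w w' : D.Frame L) :
    (V ⧸ D.plus) →ₗ[k] (V ⧸ D.plus) :=
  w.1.symm.toLinearMap ∘ₗ w'.1.toLinearMap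

/-- The fibre at `L` of the dual of the determinant bundle: linear forms on the determinant line,
given by their values on the frames. -/
def detDual (L : Submodule k V) : Submodule k (D.Frame L → k) where
  carrier := {f | ∀ w w', f w' = fdet (w.compare w') * f w}
  add_mem' := by
    intro f g hf hg w w'
    simp only [Pi.add_apply, hf w w', hg w w', mul_add]
  zero_mem' := by intro w w'; simp
  smul_mem' := by
    intro c f hf w w'
    simp only [Pi.smul_apply, smul_eq_mul, hf w w']
    ring

/-- Generators of the line `⋀(A / A ∩ V⁺) ⊗ ⋀(V⁺ / A ∩ V⁺)*` (the relative determinant of `V / V⁺`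
and `V / A`), up to the unimodular ones: isomorphisms `θ : V / A ≃ V / V⁺` that are compatible
with the projections of `V` up to an operator of finite rank. -/
def RelFrame (A : Submodule k V) : Type _ :=
  {θ : (V ⧸ A) ≃ₗ[k] (V ⧸ D.plus) //
    FiniteDimensional k (LinearMap.range (θ.toLinearMap ∘ₗ A.mkQ - D.plus.mkQ))}

/-- The composite `V / V⁺ → L → V / A → V / V⁺` of a frame of `L`, the projection, and a relative
frame of `A`. -/
def sectionMap {D : GrassData k V} {A L : Submodule k V} (θ : D.RelFrame A) (w : D.Frame L) :
    (V ⧸ D.plus) →ₗ[k] (V ⧸ D.plus) :=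
  θ.1.toLinearMap ∘ₗ proj A L ∘ₗ w.1.toLinearMap

theorem finite_range_add {M N : Type*} [AddCommGroup M] [Module k M] [AddCommGroup N] [Module k N]
    (f g : M →ₗ[k] N) (hf : FiniteDimensional k (LinearMap.range f))
    (hg : FiniteDimensional k (LinearMap.range g)) :
    FiniteDimensional k (LinearMap.range (f + g)) :=
  Submodule.finiteDimensional_of_le (LinearMap.range_add_le f g)

theorem finite_range_comp_right {M N P : Type*} [AddCommGroup M] [Module k M] [AddCommGroup N]
    [Module k N] [AddCommGroup P] [Module k P] (f : N →ₗ[k] P) (g : M →ₗ[k] N)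
    (hf : FiniteDimensional k (LinearMap.range f)) :
    FiniteDimensional k (LinearMap.range (f ∘ₗ g)) :=
  Submodule.finiteDimensional_of_le (LinearMap.range_comp_le_range g f)

theorem finite_range_comp_left {M N P : Type*} [AddCommGroup M] [Module k M] [AddCommGroup N]
    [Module k N] [AddCommGroup P] [Module k P] (f : N →ₗ[k] P) (g : M →ₗ[k] N)
    (hg : FiniteDimensional k (LinearMap.range g)) :
    FiniteDimensional k (LinearMap.range (f ∘ₗ g)) := by
  rw [LinearMap.range_comp]
  infer_instance

theorem finite_range_sectionMap {A L : Submodule k V} (θ : D.RelFrame A) (w : D.Frame L) :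
    FiniteDimensional k (LinearMap.range (sectionMap θ w - 1)) := by
  have h : sectionMap θ w - 1 =
      (θ.1.toLinearMap ∘ₗ A.mkQ - D.plus.mkQ) ∘ₗ (L.subtype ∘ₗ w.1.toLinearMap) +
        (proj D.plus L ∘ₗ w.1.toLinearMap - 1) := by
    apply LinearMap.ext
    intro x
    simp [sectionMap, proj]
  rw [h]
  exact finite_range_add _ _ (finite_range_comp_right _ _ θ.2) w.2

theorem finite_ker_proj {L : Submodule k V} (hL : L ∈ D.GrBullet) :
    FiniteDimensional k (LinearMap.ker (proj D.plus L)) := by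
  have := hL.1
  have h : (LinearMap.ker (proj D.plus L)).map L.subtype ≤ L ⊓ D.plus := by
    rintro _ ⟨x, hx, rfl⟩
    exact ⟨x.2, by simpa [proj] using hx⟩
  have := Submodule.finiteDimensional_of_le h
  exact LinearEquiv.finiteDimensional
    (Submodule.equivMapOfInjective L.subtype L.injective_subtype
      (LinearMap.ker (proj D.plus L))).symm

theorem finite_range_compare {L : Submodule k V} (hL : L ∈ D.GrBullet) (w w' : D.Frame L) :
    FiniteDimensional k (LinearMap.range (w.compare w' - 1)) := by
  have h : w.compare w' - 1 = w.1.symm.toLinearMap ∘ₗ (w'.1.toLinearMap - w.1.toLinearMap) := by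
    apply LinearMap.ext
    intro x
    simp [Frame.compare]
  rw [h]
  apply finite_range_comp_left
  set g := w'.1.toLinearMap - w.1.toLinearMap with hg
  have h1 : FiniteDimensional k (LinearMap.range (proj D.plus L ∘ₗ g)) := by
    have : proj D.plus L ∘ₗ g = (proj D.plus L ∘ₗ w'.1.toLinearMap - 1) +
        (-LinearMap.id) ∘ₗ (proj D.plus L ∘ₗ w.1.toLinearMap - 1) := by
      apply LinearMap.ext
      intro x
      simp [hg]
    rw [this]
    exact finite_range_add _ _ w'.2 (finite_range_comp_left _ _ w.2)
  have h2 := D.finite_ker_proj hL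
  rw [LinearMap.range_comp] at h1
  have hfg : (LinearMap.range g).FG := by
    refine Submodule.fg_of_fg_map_of_fg_inf_ker (proj D.plus L) ?_ ?_
    · exact (Submodule.fg_iff_finiteDimensional _).2 h1
    · exact (Submodule.fg_iff_finiteDimensional _).2
        (Submodule.finiteDimensional_of_le inf_le_right)
  exact (Submodule.fg_iff_finiteDimensional _).1 hfg

/-- The value at `L` of the section attached to `A` (and to a relative frame of `A`): the
determinant of `L → V / A`. -/
def sectionAt {A : Submodule k V} (θ : D.RelFrame A) (L : D.Gr) : D.detDual L :=
  ⟨fun w => fdet (sectionMap θ w), by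
    intro w w'
    have h1 := D.finite_range_sectionMap θ w
    have h2 := D.finite_range_compare L.2.1 w w'
    have h : sectionMap θ w' = sectionMap θ w * w.compare w' := by
      apply LinearMap.ext
      intro x
      simp [sectionMap, Frame.compare]
    change fdet (sectionMap θ w') = _ * fdet (sectionMap θ w)
    rw [h, fdet_mul, mul_comm]⟩

/-- The space `Ω` of sections (on the rational points) of the dual determinant bundle spanned by
the sections `Ω_A`, `A ∈ 𝓑₀`. -/
def Omega : Submodule k ((L : D.Gr) → D.detDual (L : Submodule k V)) :=
  Submodule.span k {s | ∃ A ∈ D.nhdZero, ∃ θ : D.RelFrame A, s = D.sectionAt θ}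

/-- The evaluation `Ω → D_L` at a rational point `L`. -/
def evalAt (L : D.Gr) : D.Omega →ₗ[k] D.detDual (L : Submodule k V) :=
  LinearMap.proj L ∘ₗ D.Omega.subtype

/-! ### The Plücker map on rational points -/

theorem exists_frame (L : D.Gr) : Nonempty (D.Frame (L : Submodule k V)) := by
  obtain ⟨L, hL, hi⟩ := L
  have h1 := D.finite_ker_proj hL
  have hk : (LinearMap.ker (proj D.plus L)).map L.subtype = L ⊓ D.plus := by
    ext x
    constructor
    · rintro ⟨x, hx, rfl⟩
      exact ⟨x.2, by simpa [proj] using hx⟩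
    · rintro ⟨hx, hx'⟩
      exact ⟨⟨x, hx⟩, by simpa [proj] using hx', rfl⟩
  have hr : LinearMap.range (proj D.plus L) = L.map D.plus.mkQ := by
    rw [proj, LinearMap.range_comp, Submodule.range_subtype]
  let q : ((V ⧸ D.plus) ⧸ LinearMap.range (proj D.plus L)) ≃ₗ[k] V ⧸ (L ⊔ D.plus) :=
    (Submodule.quotEquivOfEq _ _ hr) ≪≫ₗ (Submodule.quotientQuotientEquivQuotientSup D.plus L) ≪≫ₗ
      (Submodule.quotEquivOfEq _ _ (sup_comm _ _))
  have := hL.2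
  have h2 : FiniteDimensional k ((V ⧸ D.plus) ⧸ LinearMap.range (proj D.plus L)) :=
    LinearEquiv.finiteDimensional q.symm
  obtain ⟨w, hw⟩ := exists_equiv_of_index_zero (proj D.plus L) (by
    rw [q.finrank_eq, (Submodule.equivMapOfInjective L.subtype L.injective_subtype
      (LinearMap.ker (proj D.plus L))).finrank_eq, hk]
    have := hi
    simp only [index] at this
    omega)
  exact ⟨⟨w, hw⟩⟩

theorem finrank_detDual (L : D.Gr) : Module.finrank k (D.detDual (L : Submodule k V)) = 1 := by
  obtain ⟨w₀⟩ := D.exists_frame L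
  have hc : ∀ w : D.Frame (L : Submodule k V), w.compare w = 1 := by
    intro w
    apply LinearMap.ext
    intro x
    simp [Frame.compare]
  let f₀ : D.detDual (L : Submodule k V) := ⟨fun w => fdet (w₀.compare w), by
    intro w w'
    have h1 := D.finite_range_compare L.2.1 w₀ w
    have h2 := D.finite_range_compare L.2.1 w w'
    have h : w₀.compare w' = w₀.compare w * w.compare w' := by
      apply LinearMap.ext
      intro x
      simp [Frame.compare]
    change fdet (w₀.compare w') = _ * fdet (w₀.compare w)
    rw [h, fdet_mul, mul_comm]⟩
  refine finrank_eq_one f₀ ?_ ?_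
  · intro h
    have := congrFun (congrArg Subtype.val h) w₀
    simp [f₀, hc, fdet_one] at this
  · intro f
    refine ⟨f.1 w₀, Subtype.ext (funext fun w => ?_)⟩
    have := f.2 w₀ w
    simp only [f₀, Submodule.coe_smul, Pi.smul_apply, smul_eq_mul]
    rw [this, mul_comm]

/-- Some member of `𝓑` meets a given finite-dimensional subspace only in `0`. -/
theorem exists_disjoint (K : Submodule k V) [FiniteDimensional k K] :
    ∃ B ∈ D.nhd, K ⊓ B = ⊥ := by
  obtain ⟨B, hB, hmin⟩ := exists_minimal_of_wellFoundedLT (fun n : ℕ => ∃ B ∈ D.nhd,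
    Module.finrank k ↥(K ⊓ B) = n) ⟨_, D.plus, D.plus_mem, rfl⟩ |>.imp fun n hn => hn
  obtain ⟨B', hB', rfl⟩ := hB
  refine ⟨B', hB', ?_⟩
  by_contra hne
  obtain ⟨x, hx, hx0⟩ := Submodule.exists_mem_ne_zero_of_ne_bot hne
  have hx1 : x ∉ sInf D.nhd := by rw [D.separated]; simpa using hx0
  rw [Submodule.mem_sInf] at hx1
  push Not at hx1
  obtain ⟨C, hC, hxC⟩ := hx1
  have hlt : K ⊓ (B' ⊓ C) < K ⊓ B' := by
    refine lt_of_le_of_ne (inf_le_inf_left _ inf_le_left) fun h => hxC ?_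
    rw [← h] at hx
    exact hx.2.2
  have hfin : FiniteDimensional k ↥(K ⊓ B') := Submodule.finiteDimensional_of_le inf_le_left
  have h1 := Submodule.finrank_lt_finrank_of_lt hlt
  have h2 := hmin ⟨B' ⊓ C, D.inf_mem _ hB' _ hC, rfl⟩ h1.le
  omega

theorem nhdSat_le {A : Submodule k V} (hA : A ∈ D.nhdSat) :
    (∃ F : Submodule k V, FiniteDimensional k F ∧ A ≤ D.plus ⊔ F) ∧
      ∃ F : Submodule k V, FiniteDimensional k F ∧ D.plus ≤ A ⊔ F := by
  obtain ⟨B, hB, hBA, hfin⟩ := hA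
  obtain ⟨F, hF, hAF⟩ := (finite_relQuot_iff _ _).1 hfin
  obtain ⟨G, hG, hBG⟩ := (finite_relQuot_iff _ _).1 (D.commensurable B hB D.plus D.plus_mem)
  refine ⟨⟨G ⊔ F, inferInstance, ?_⟩, ⟨G, hG, ?_⟩⟩
  · refine hAF.trans (sup_le ?_ (le_sup_right.trans le_sup_right))
    refine (le_sup_left.trans hBG).trans (sup_le (inf_le_right.trans le_sup_left) ?_)
    exact le_sup_left.trans le_sup_right
  · exact (le_sup_right.trans hBG).trans (sup_le_sup_right (inf_le_left.trans hBA) _)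

theorem mem_nhdZero_of_isCompl {L A : Submodule k V} (hL : L ∈ D.Gr) (hA : A ∈ D.nhdSat)
    (hLA : IsCompl L A) : A ∈ D.nhdZero := by
  refine ⟨hA, ?_⟩
  obtain ⟨⟨hL1, hL2⟩, hi⟩ := hL
  set P := D.plus with hP
  set I := A ⊓ P with hI
  have hX : FiniteDimensional k (RelQuot I P) := by
    obtain ⟨F, hF, hPF⟩ := (D.nhdSat_le hA).2
    have : FiniteDimensional k (RelQuot A P) := (finite_relQuot_iff _ _).2 ⟨F, hF, hPF⟩
    have e : A.submoduleOf P = I.submoduleOf P := by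
      ext x; simp [Submodule.submoduleOf, hI]
    exact LinearEquiv.finiteDimensional (Submodule.quotEquivOfEq _ _ e)
  have hXA : FiniteDimensional k (RelQuot I A) := by
    obtain ⟨F, hF, hPF⟩ := (D.nhdSat_le hA).1
    have : FiniteDimensional k (RelQuot P A) := (finite_relQuot_iff _ _).2 ⟨F, hF, hPF⟩
    have e : P.submoduleOf A = I.submoduleOf A := by
      ext x; simp [Submodule.submoduleOf, hI]
    exact LinearEquiv.finiteDimensional (Submodule.quotEquivOfEq _ _ e)
  -- `A / I ≃ V / (L + I)`
  let χ : A →ₗ[k] V ⧸ (L ⊔ I) := (L ⊔ I).mkQ ∘ₗ A.subtype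
  have hχs : Function.Surjective χ := by
    intro y
    obtain ⟨v, rfl⟩ := Submodule.mkQ_surjective _ y
    have hv : v ∈ L ⊔ A := by rw [hLA.sup_eq_top]; trivial
    obtain ⟨l, hl, a, ha, rfl⟩ := Submodule.mem_sup.1 hv
    refine ⟨⟨a, ha⟩, ?_⟩
    change Submodule.Quotient.mk a = Submodule.Quotient.mk (l + a)
    rw [Submodule.Quotient.eq]
    simpa using Submodule.mem_sup_left (T := I) hl
  have hχk : I.submoduleOf A = LinearMap.ker χ := by
    ext ⟨a, ha⟩
    simp only [Submodule.submoduleOf, Submodule.mem_comap, LinearMap.mem_ker, χ,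
      LinearMap.comp_apply, Submodule.subtype_apply, Submodule.mkQ_apply,
      Submodule.Quotient.mk_eq_zero]
    constructor
    · exact fun h => Submodule.mem_sup_right h
    · intro h
      obtain ⟨l, hl, i, hi, hli⟩ := Submodule.mem_sup.1 h
      have hlA : l ∈ L ⊓ A := ⟨hl, by
        have : l = a - i := by rw [← hli]; abel
        rw [this]
        exact A.sub_mem ha hi.1⟩
      rw [hLA.inf_eq_bot, Submodule.mem_bot] at hlA
      rw [← hli, hlA, zero_add]
      exact hi
  let eY : RelQuot I A ≃ₗ[k] V ⧸ (L ⊔ I) :=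
    (Submodule.quotEquivOfEq _ _ hχk) ≪≫ₗ (χ.quotKerEquivOfSurjective hχs)
  have hY : FiniteDimensional k (V ⧸ (L ⊔ I)) := LinearEquiv.finiteDimensional eY
  rw [eY.finrank_eq]
  -- `P / I → V / (L + I)`
  let φ : RelQuot I P →ₗ[k] V ⧸ (L ⊔ I) :=
    (I.submoduleOf P).mapQ (L ⊔ I) P.subtype fun x hx => Submodule.mem_sup_right hx
  have hφr : LinearMap.range φ = P.map (L ⊔ I).mkQ := by
    ext y
    constructor
    · rintro ⟨x, rfl⟩
      obtain ⟨x, rfl⟩ := Submodule.mkQ_surjective _ x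
      exact ⟨x.1, x.2, rfl⟩
    · rintro ⟨x, hx, rfl⟩
      exact ⟨Submodule.Quotient.mk ⟨x, hx⟩, rfl⟩
  have hsup : L ⊔ I ⊔ P = L ⊔ P := by
    rw [sup_assoc, sup_eq_right.2 (inf_le_right : I ≤ P)]
  let q : ((V ⧸ (L ⊔ I)) ⧸ LinearMap.range φ) ≃ₗ[k] V ⧸ (L ⊔ P) :=
    (Submodule.quotEquivOfEq _ _ hφr) ≪≫ₗ (Submodule.quotientQuotientEquivQuotientSup _ P) ≪≫ₗ
      (Submodule.quotEquivOfEq _ _ hsup)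
  let ψ : ↥(L ⊓ P) →ₗ[k] RelQuot I P :=
    (I.submoduleOf P).mkQ ∘ₗ Submodule.inclusion (inf_le_right : L ⊓ P ≤ P)
  have hψi : Function.Injective ψ := by
    rw [injective_iff_map_eq_zero]
    intro x hx
    have hx₀ : Submodule.inclusion (inf_le_right : L ⊓ P ≤ P) x ∈ I.submoduleOf P :=
      (Submodule.Quotient.mk_eq_zero _).1 hx
    have hx' : (x : V) ∈ I := hx₀
    have : (x : V) ∈ L ⊓ A := ⟨x.2.1, hx'.1⟩
    rw [hLA.inf_eq_bot, Submodule.mem_bot] at this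
    exact Subtype.ext this
  have hψr : LinearMap.range ψ = LinearMap.ker φ := by
    ext y
    constructor
    · rintro ⟨x, rfl⟩
      exact (Submodule.Quotient.mk_eq_zero _).2 (Submodule.mem_sup_left x.2.1)
    · intro hy
      obtain ⟨⟨y, hyP⟩, rfl⟩ := Submodule.mkQ_surjective _ y
      have hy' : y ∈ L ⊔ I := (Submodule.Quotient.mk_eq_zero _).1 hy
      obtain ⟨l, hl, i, hi, hli⟩ := Submodule.mem_sup.1 hy'
      have hlP : l ∈ P := by
        have : l = y - i := by rw [← hli]; abel
        rw [this]
        exact P.sub_mem hyP hi.2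
      refine ⟨⟨l, hl, hlP⟩, (Submodule.Quotient.eq _).2 ?_⟩
      change l - y ∈ I
      have : l - y = -i := by rw [← hli]; abel
      rw [this]
      exact I.neg_mem hi
  have h1 := LinearMap.finrank_range_add_finrank_ker φ
  have h2 := Submodule.finrank_quotient_add_finrank (LinearMap.range φ)
  have h3 := LinearMap.finrank_range_of_inj hψi
  rw [hψr] at h3
  rw [q.finrank_eq] at h2
  simp only [index] at hi
  rw [← hP] at hi
  omega

/-- Every rational point has a complement in `𝓑₀`: the open sets `F_A` cover. -/
theorem exists_compl (L : D.Gr) : ∃ A ∈ D.nhdZero, IsCompl (L : Submodule k V) A := by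
  obtain ⟨L, hL⟩ := L
  have hL1 := hL.1.1
  have hL2 := hL.1.2
  obtain ⟨B₀, hB₀, hdis⟩ := D.exists_disjoint (L ⊓ D.plus)
  set B := D.plus ⊓ B₀ with hBdef
  have hB : B ∈ D.nhd := D.inf_mem _ D.plus_mem _ hB₀
  have hLB : Disjoint L B := by
    rw [disjoint_iff, hBdef, ← inf_assoc, hdis]
  have hBsat : B ∈ D.nhdSat := ⟨B, hB, le_rfl, (finite_relQuot_iff _ _).2
    ⟨⊥, inferInstance, le_sup_left⟩⟩
  obtain ⟨F, hF, hPF⟩ := (D.nhdSat_le hBsat).2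
  obtain ⟨G, hG⟩ := Submodule.exists_isCompl (L ⊔ D.plus)
  have hGf : FiniteDimensional k G :=
    LinearEquiv.finiteDimensional (Submodule.quotientEquivOfIsCompl _ _ hG)
  obtain ⟨C, hC⟩ := Submodule.exists_isCompl (L ⊔ B)
  have htop : (⊤ : Submodule k V) ≤ (L ⊔ B) ⊔ (F ⊔ G) := by
    rw [← hG.sup_eq_top]
    refine sup_le (sup_le (le_sup_left.trans le_sup_left) (hPF.trans ?_))
      (le_sup_right.trans le_sup_right)
    exact sup_le_sup le_sup_right le_sup_left
  have hq : FiniteDimensional k (RelQuot (L ⊔ B) C) :=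
    (finite_relQuot_iff _ _).2 ⟨F ⊔ G, inferInstance, le_top.trans htop⟩
  have hCf : FiniteDimensional k C := by
    have e : (L ⊔ B).submoduleOf C = ⊥ := by
      rw [Submodule.submoduleOf, ← Submodule.disjoint_iff_comap_eq_bot]
      exact hC.disjoint.symm
    exact LinearEquiv.finiteDimensional
      ((Submodule.quotEquivOfEq _ _ e) ≪≫ₗ (Submodule.quotEquivOfEqBot _ rfl))
  have hcompl : IsCompl L (B ⊔ C) := by
    refine ⟨hLB.disjoint_sup_right_of_disjoint_sup_left hC.disjoint, ?_⟩
    rw [codisjoint_iff, ← sup_assoc, hC.sup_eq_top]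
  have hsat : B ⊔ C ∈ D.nhdSat :=
    ⟨B, hB, le_sup_left, (finite_relQuot_iff _ _).2 ⟨C, hCf, le_rfl⟩⟩
  exact ⟨B ⊔ C, D.mem_nhdZero_of_isCompl hL hsat hcompl, hcompl⟩

theorem exists_relFrame {A : Submodule k V} (hA : A ∈ D.nhdZero) {L : Submodule k V}
    (hLA : IsCompl L A) (w : D.Frame L) : ∃ θ : D.RelFrame A, sectionMap θ w = 1 := by
  let p := Submodule.quotientEquivOfIsCompl A L hLA.symm
  let θ : (V ⧸ A) ≃ₗ[k] (V ⧸ D.plus) := p ≪≫ₗ w.1.symm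
  have hpl : ∀ l : L, p (Submodule.Quotient.mk (l : V)) = l := fun l =>
    Submodule.quotientEquivOfIsCompl_apply_mk_right hLA.symm l
  obtain ⟨F, hF, hAF⟩ := (D.nhdSat_le hA.1).1
  have hAm : FiniteDimensional k (A.map D.plus.mkQ) := by
    have hle : A.map D.plus.mkQ ≤ F.map D.plus.mkQ := by
      refine (Submodule.map_mono hAF).trans ?_
      rw [Submodule.map_sup]
      simp
    exact Submodule.finiteDimensional_of_le hle
  have hw := w.2
  have hle : LinearMap.range (θ.toLinearMap ∘ₗ A.mkQ - D.plus.mkQ) ≤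
      A.map D.plus.mkQ ⊔ LinearMap.range (proj D.plus L ∘ₗ w.1.toLinearMap - 1) := by
    rintro _ ⟨v, rfl⟩
    have hv : v ∈ A ⊔ L := by rw [hLA.symm.sup_eq_top]; trivial
    obtain ⟨a, ha, l, hl, rfl⟩ := Submodule.mem_sup.1 hv
    rw [map_add]
    refine Submodule.add_mem_sup ?_ ?_
    · refine ⟨-a, A.neg_mem ha, ?_⟩
      have : A.mkQ a = 0 := by simpa using ha
      simp only [LinearMap.sub_apply, LinearMap.comp_apply, this, map_zero, map_neg, zero_sub]
    · refine ⟨-(w.1.symm ⟨l, hl⟩), ?_⟩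
      have h1 : θ (A.mkQ l) = w.1.symm ⟨l, hl⟩ := congrArg w.1.symm (hpl ⟨l, hl⟩)
      simp only [LinearMap.sub_apply, LinearMap.comp_apply, LinearEquiv.coe_coe, h1, map_neg,
        LinearEquiv.apply_symm_apply, Module.End.one_apply]
      simp [proj]
  refine ⟨⟨θ, Submodule.finiteDimensional_of_le hle⟩, ?_⟩
  apply LinearMap.ext
  intro x
  change w.1.symm (p (Submodule.Quotient.mk (w.1 x : V))) = x
  rw [hpl, LinearEquiv.symm_apply_apply]

theorem surjective_evalAt (L : D.Gr) : Function.Surjective (D.evalAt L) := by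
  obtain ⟨w⟩ := D.exists_frame L
  obtain ⟨A, hA, hLA⟩ := D.exists_compl L
  obtain ⟨θ, hθ⟩ := D.exists_relFrame hA hLA w
  have hne : D.sectionAt θ L ≠ 0 := by
    intro h
    have := congrFun (congrArg Subtype.val h) w
    simp [sectionAt, hθ, fdet_one] at this
  intro f
  obtain ⟨c, hc⟩ := exists_smul_eq_of_finrank_eq_one (D.finrank_detDual L) hne f
  exact ⟨c • ⟨D.sectionAt θ, Submodule.subset_span ⟨A, hA, θ, rfl⟩⟩, hc⟩

/-- The line in `Ω*` that is dual to the one-dimensional quotient `Ω → D_L`. -/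
theorem finrank_range_dualMap (L : D.Gr) :
    Module.finrank k (LinearMap.range (D.evalAt L).dualMap) = 1 := by
  rw [LinearMap.finrank_range_of_inj
    (LinearMap.dualMap_injective_of_surjective (D.surjective_evalAt L)),
    Subspace.dual_finrank_eq, D.finrank_detDual L]

/-- The Plücker map on rational points. The rational points of `ℙΩ* = Proj (Sym Ω)` are the
one-dimensional quotients of `Ω`, or, dually, the points of the projectivization of the dual space
`Ω*`; the point `L` goes to the quotient `Ω → D_L`. -/
def plucker (L : D.Gr) : Projectivization k (Module.Dual k D.Omega) :=
  Projectivization.mk'' (LinearMap.range (D.evalAt L).dualMap) (D.finrank_range_dualMap L)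

end GrassData

/-- Three points of the projectivization of `E` lie in a line, a line being given by a
two-dimensional subspace of `E`. -/
def LieInALine {k E : Type*} [Field k] [AddCommGroup E] [Module k E]
    (p₁ p₂ p₃ : Projectivization k E) : Prop :=
  ∃ W : Submodule k E, Module.finrank k W = 2 ∧
    p₁.submodule ≤ W ∧ p₂.submodule ≤ W ∧ p₃.submodule ≤ W

/-- `P ⊆ Q`, of codimension `1`. -/
def LeOfCodimOne {k V : Type*} [Field k] [AddCommGroup V] [Module k V]
    (P Q : Submodule k V) : Prop :=
  P ≤ Q ∧ Module.finrank k (RelQuot P Q) = 1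

end

end InfGrass

/-!
Three points of `ℙΩ*` lie in a line if and only if every section in `Ω` that vanishes at the first
two also vanishes at the third. Since `Ω_A` vanishes at `L` exactly when `L ∩ A ≠ 0` or `L + A ≠ V`,
and every finite-dimensional `E` with `E ∩ L₃ = 0` is contained in a complement `A ∈ 𝓑₀` of `L₃`,
collinearity forces every finite-dimensional `E` that meets both `L₁` and `L₂` to meet `L₃`. For
`E` a line this gives `L₁ ∩ L₂ ⊆ L₃`, and for `E` a plane it shows that each of the three subspaces
has codimension `1` in the sum of all three; the rest is modularity of the lattice of subspaces.

Conversely, the codimension conditions put the three points in a pencil `I ⊕ kx`, `I ⊕ ky`,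
`I ⊕ k(x + y)`. Moving a frame of the first by transvections gives frames of the other two that
differ from it in one column only, and additivity of the determinant in that column yields
`Ω_A(L₃) = Ω_A(L₁) + Ω_A(L₂)` for all `A` at once.
-/

namespace InfGrass

section ModularLattice

variable {α : Type*} [Lattice α] [IsLowerModularLattice α] {a b c s : α}

theorem inf_covBy_of_inf_le (ha : a ⋖ s) (hb : b ⋖ s) (hc : c ⋖ s) (hab : a ≠ b) (hac : a ≠ c)
    (h : a ⊓ b ≤ c) : a ⊓ b ⋖ c := by
  have hab_sup : a ⊔ b = s := ha.wcovBy.sup_eq hb.wcovBy hab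
  have hac_sup : a ⊔ c = s := ha.wcovBy.sup_eq hc.wcovBy hac
  have hab_inf : a ⊓ b ⋖ a := inf_covBy_of_covBy_sup_right (hab_sup ▸ hb)
  have hac_inf : a ⊓ c ⋖ a := inf_covBy_of_covBy_sup_right (hac_sup ▸ hc)
  have hinf : a ⊓ c = a ⊓ b :=
    (hab_inf.eq_or_eq (le_inf inf_le_left h) inf_le_left).resolve_right hac_inf.ne
  exact hinf ▸ inf_covBy_of_covBy_sup_left (hac_sup ▸ ha)

theorem inf_covBy_left_of_covBy (h_inf : a ⊓ b ⋖ c) (h_sup : c ⋖ a ⊔ b) (hac : ¬a ≤ c)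
    (hca : ¬c ≤ a) : a ⊓ b ⋖ a := by
  have hsup : a ⊔ c = a ⊔ b :=
    (h_sup.eq_or_eq le_sup_right (sup_le le_sup_left h_sup.le)).resolve_left
      fun h => hac (sup_eq_right.1 h)
  have hinf : a ⊓ c = a ⊓ b :=
    (h_inf.eq_or_eq (le_inf inf_le_left h_inf.le) inf_le_right).resolve_right
      fun h => hca (inf_eq_right.1 h)
  exact hinf ▸ inf_covBy_of_covBy_sup_right (hsup ▸ h_sup)

end ModularLattice

section Subspaces

theorem leOfCodimOne_iff_covBy {k V : Type*} [Field k] [AddCommGroup V] [Module k V]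
    {P Q : Submodule k V} : LeOfCodimOne P Q ↔ P ⋖ Q := by
  constructor
  · rintro ⟨hPQ, h⟩
    exact (covBy_iff_quot_is_simple hPQ).2 (isSimpleModule_iff_finrank_eq_one.2 h)
  · intro h
    exact ⟨h.le, isSimpleModule_iff_finrank_eq_one.1 ((covBy_iff_quot_is_simple h.le).1 h)⟩

theorem sup_span_singleton_eq_of_covBy {R M : Type*} [Semiring R] [AddCommMonoid M] [Module R M]
    {P Q : Submodule R M} (h : P ⋖ Q) {x : M} (hxQ : x ∈ Q) (hxP : x ∉ P) :
    P ⊔ Submodule.span R {x} = Q :=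
  (h.eq_or_eq le_sup_left
    (sup_le h.le ((Submodule.span_singleton_le_iff_mem _ _).2 hxQ))).resolve_left fun heq =>
      hxP (heq ▸ Submodule.mem_sup_right (Submodule.mem_span_singleton_self x))

theorem finiteDimensional_sup_inf_of_disjoint {k V : Type*} [DivisionRing k] [AddCommGroup V]
    [Module k V] {L A E : Submodule k V} [FiniteDimensional k E] (h : Disjoint L A) :
    FiniteDimensional k ↥((L ⊔ E) ⊓ A) := by
  rw [← Submodule.fg_iff_finiteDimensional]
  refine Submodule.fg_of_fg_map_of_fg_inf_ker L.mkQ ?_ ?_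
  · have hmap : ((L ⊔ E) ⊓ A).map L.mkQ ≤ E.map L.mkQ := by
      refine (Submodule.map_mono inf_le_left).trans ?_
      rw [Submodule.map_sup, Submodule.mkQ_map_self, bot_sup_eq]
    exact (Submodule.fg_iff_finiteDimensional _).2 (Submodule.finiteDimensional_of_le hmap)
  · have hbot : (L ⊔ E) ⊓ A ⊓ L = ⊥ := (h.symm.mono_left inf_le_right).eq_bot
    rw [Submodule.ker_mkQ, hbot]
    exact Submodule.fg_bot

end Subspaces

section ProjectiveSpace

theorem finrank_submodule_sup_submodule {k E : Type*} [DivisionRing k] [AddCommGroup E] [Module k E]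
    {p₁ p₂ : Projectivization k E} (h : p₁ ≠ p₂) :
    Module.finrank k ↥(p₁.submodule ⊔ p₂.submodule) = 2 := by
  rw [← Projectivization.independent_pair_iff_ne, Projectivization.independent_iff] at h
  have hspan := finrank_span_eq_card h
  rwa [Set.range_comp, Matrix.range_cons_cons_empty, Set.image_pair, Submodule.span_insert,
    ← p₁.submodule_eq, ← p₂.submodule_eq, Fintype.card_fin] at hspan

variable {k E : Type*} [Field k] [AddCommGroup E] [Module k E] {p₁ p₂ p₃ : Projectivization k E}

theorem LieInALine.swap (h : LieInALine p₁ p₂ p₃) : LieInALine p₂ p₁ p₃ := by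
  obtain ⟨W, hW, h₁, h₂, h₃⟩ := h
  exact ⟨W, hW, h₂, h₁, h₃⟩

theorem LieInALine.rotate (h : LieInALine p₁ p₂ p₃) : LieInALine p₂ p₃ p₁ := by
  obtain ⟨W, hW, h₁, h₂, h₃⟩ := h
  exact ⟨W, hW, h₂, h₃, h₁⟩

theorem lieInALine_iff_submodule_le_sup (h : p₁ ≠ p₂) :
    LieInALine p₁ p₂ p₃ ↔ p₃.submodule ≤ p₁.submodule ⊔ p₂.submodule := by
  have hfinrank := finrank_submodule_sup_submodule h
  constructor
  · rintro ⟨W, hW, h₁, h₂, h₃⟩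
    have : FiniteDimensional k W := Module.finite_of_finrank_eq_succ hW
    rwa [Submodule.eq_of_le_of_finrank_eq (sup_le h₁ h₂) (hfinrank.trans hW.symm)]
  · exact fun h₃ => ⟨_, hfinrank, le_sup_left, le_sup_right, h₃⟩

-- Over an `AddCommMonoid` the unifier need not reconcile two additive structures on `D.Omega`.
theorem lieInALine_iff_inf_le {k E : Type*} [Field k] [AddCommMonoid E] [Module k E]
    {p₁ p₂ p₃ : Projectivization k (Module.Dual k E)} {K₁ K₂ K₃ : Submodule k E} (h : p₁ ≠ p₂)
    (h₁ : p₁.submodule = K₁.dualAnnihilator) (h₂ : p₂.submodule = K₂.dualAnnihilator)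
    (h₃ : p₃.submodule = K₃.dualAnnihilator) : LieInALine p₁ p₂ p₃ ↔ K₁ ⊓ K₂ ≤ K₃ := by
  let : AddCommGroup E := Module.addCommMonoidToAddCommGroup k
  rw [lieInALine_iff_submodule_le_sup h, h₁, h₂, h₃, ← Subspace.dualAnnihilator_inf_eq]
  exact Subspace.dualAnnihilator_le_dualAnnihilator_iff

end ProjectiveSpace

section FredholmDet

variable {k M : Type*} [Field k] [AddCommGroup M] [Module k M]

theorem fdet_eq_zero_of_apply_eq_zero (T : M →ₗ[k] M)
    [FiniteDimensional k (LinearMap.range (T - 1))] {x : M} (hx : x ≠ 0) (hTx : T x = 0) :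
    fdet T = 0 := by
  have hx_range : x ∈ LinearMap.range (T - 1) := ⟨-x, by simp [hTx]⟩
  by_contra hdet
  have hker := (LinearMap.equivOfDetNeZero _ hdet).ker
  have hx_ker := LinearMap.ker_eq_bot'.1 hker ⟨x, hx_range⟩ (Subtype.ext hTx)
  exact hx (congrArg Subtype.val hx_ker)

theorem mapsTo_of_range_sub_one_le {R N : Type*} [Ring R] [AddCommGroup N] [Module R N]
    {T : N →ₗ[R] N} {U : Submodule R N} (h : LinearMap.range (T - 1) ≤ U) : ∀ x ∈ U, T x ∈ U := by
  intro x hx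
  have hTx : T x = (T - 1) x + x := by simp
  exact hTx ▸ U.add_mem (h ⟨x, rfl⟩) hx

theorem det_add_of_eqOn_ker [FiniteDimensional k M] (φ : M →ₗ[k] k) {p : M} (hp : φ p ≠ 0)
    {R S T : M →ₗ[k] M} (hS : ∀ x, φ x = 0 → S x = R x) (hT : ∀ x, φ x = 0 → T x = R x)
    (hadd : R p = S p + T p) :
    LinearMap.det R = LinearMap.det S + LinearMap.det T := by
  let c := Module.finBasis k (LinearMap.ker φ)
  have hp_indep : ∀ a : k, ∀ x ∈ LinearMap.ker φ, a • p + x = 0 → a = 0 := by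
    intro a x hx h
    have hφ : φ (a • p + x) = 0 := by rw [h, map_zero]
    simpa [LinearMap.mem_ker.1 hx, hp] using hφ
  have hp_span : ∀ z : M, ∃ a : k, z + a • p ∈ LinearMap.ker φ := fun z =>
    ⟨-(φ z / φ p), by simp [hp]⟩
  let b := Module.Basis.mkFinCons p c hp_indep hp_span
  have hb : (b : Fin (_ + 1) → M) = Fin.cons p ((↑) ∘ c) := Module.Basis.coe_mkFinCons ..
  have det_eq_update : ∀ Q : M →ₗ[k] M, (∀ x, φ x = 0 → Q x = R x) →
      LinearMap.det Q = b.det (Function.update (R ∘ b) 0 (Q p)) := by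
    intro Q hQ
    have hQb : Q ∘ b = Function.update (R ∘ b) 0 (Q p) := by
      funext i
      refine Fin.cases ?_ (fun j => ?_) i
      · simp [hb]
      · simp [hb, hQ]
    rw [← hQb, Module.Basis.det_comp, Module.Basis.det_self, mul_one]
  rw [det_eq_update R fun _ _ => rfl, det_eq_update S hS, det_eq_update T hT, hadd]
  exact b.det.map_update_add _ _ _ _

theorem fdet_add_of_eqOn_ker (φ : M →ₗ[k] k) {p : M} (hp : φ p ≠ 0) {R S T : M →ₗ[k] M}
    [FiniteDimensional k (LinearMap.range (R - 1))]
    [FiniteDimensional k (LinearMap.range (S - 1))]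
    [FiniteDimensional k (LinearMap.range (T - 1))]
    (hS : ∀ x, φ x = 0 → S x = R x) (hT : ∀ x, φ x = 0 → T x = R x)
    (hadd : R p = S p + T p) : fdet R = fdet S + fdet T := by
  let U := LinearMap.range (R - 1) ⊔ LinearMap.range (S - 1) ⊔ LinearMap.range (T - 1) ⊔
    Submodule.span k {p}
  have hRU : LinearMap.range (R - 1) ≤ U := le_sup_left.trans (le_sup_left.trans le_sup_left)
  have hSU : LinearMap.range (S - 1) ≤ U := le_sup_right.trans (le_sup_left.trans le_sup_left)
  have hTU : LinearMap.range (T - 1) ≤ U := le_sup_right.trans le_sup_left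
  have hpU : p ∈ U := Submodule.mem_sup_right (Submodule.mem_span_singleton_self p)
  rw [← det_restrict_eq_fdet R U hRU (mapsTo_of_range_sub_one_le hRU),
    ← det_restrict_eq_fdet S U hSU (mapsTo_of_range_sub_one_le hSU),
    ← det_restrict_eq_fdet T U hTU (mapsTo_of_range_sub_one_le hTU)]
  exact det_add_of_eqOn_ker (φ ∘ₗ U.subtype) (p := ⟨p, hpU⟩) hp
    (fun x hx => Subtype.ext (hS x hx)) (fun x hx => Subtype.ext (hT x hx)) (Subtype.ext hadd)

end FredholmDet

section Transvection

variable {k V : Type*} [Field k] [AddCommGroup V] [Module k V]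

instance finiteDimensional_range_transvection_sub_one (f : Module.Dual k V) (v : V) :
    FiniteDimensional k (LinearMap.range (LinearMap.transvection f v - 1)) := by
  refine Submodule.finiteDimensional_of_le (S₂ := Submodule.span k {v}) ?_
  rintro _ ⟨x, rfl⟩
  exact Submodule.mem_span_singleton.2 ⟨f x, by simp [LinearMap.transvection.apply]⟩

variable {I : Submodule k V} {f : Module.Dual k V} {x y : V}

theorem map_transvection_sup_span_singleton (hI : I ≤ LinearMap.ker f) (hx : f x = 1) :
    (I ⊔ Submodule.span k {x}).map (LinearMap.transvection f (y - x)) =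
      I ⊔ Submodule.span k {y} := by
  have hmapI : I.map (LinearMap.transvection f (y - x)) = I := by
    have hid : ∀ i : I, LinearMap.transvection f (y - x) (i : V) = i := fun i => by
      rw [LinearMap.transvection.apply, LinearMap.mem_ker.1 (hI i.2), zero_smul, add_zero]
    ext z
    simp only [Submodule.mem_map]
    exact ⟨fun ⟨i, hi, h⟩ => h ▸ (hid ⟨i, hi⟩).symm ▸ hi, fun hz => ⟨z, hz, hid ⟨z, hz⟩⟩⟩
  have hmapx : LinearMap.transvection f (y - x) x = y := by
    rw [LinearMap.transvection.apply, hx, one_smul, add_sub_cancel]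
  rw [Submodule.map_sup, hmapI, Submodule.map_span, Set.image_singleton, hmapx]

theorem disjoint_ker_transvection (hI : I ≤ LinearMap.ker f) (hx : f x = 1) (hy : y ∉ I) :
    Disjoint (I ⊔ Submodule.span k {x}) (LinearMap.ker (LinearMap.transvection f (y - x))) := by
  rw [Submodule.disjoint_def]
  intro z hz hker
  obtain ⟨i, hi, _, hcx, rfl⟩ := Submodule.mem_sup.1 hz
  obtain ⟨c, rfl⟩ := Submodule.mem_span_singleton.1 hcx
  have hsum : i + c • y = 0 := by
    have hfi : f i = 0 := hI hi
    rw [LinearMap.mem_ker, LinearMap.transvection.apply, map_add, hfi, map_smul, hx, smul_eq_mul,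
      mul_one, zero_add, smul_sub] at hker
    rw [← hker]
    abel
  have hc : c = 0 := by
    by_contra hc
    refine hy ((I.smul_mem_iff hc).1 ?_)
    rw [eq_neg_of_add_eq_zero_right hsum]
    exact I.neg_mem hi
  rw [hc, zero_smul, add_zero] at hsum ⊢
  exact hsum

end Transvection

namespace GrassData

variable {k V : Type*} [Field k] [AddCommGroup V] [Module k V] {D : GrassData k V}

section Neighbourhoods

theorem exists_finiteDimensional_le_sup {A B : Submodule k V} (hA : A ∈ D.nhdSat)
    (hB : B ∈ D.nhd) : ∃ F : Submodule k V, FiniteDimensional k F ∧ A ≤ B ⊔ F := by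
  obtain ⟨F, hF, hAF⟩ := (D.nhdSat_le hA).1
  have hB_sat : B ∈ D.nhdSat :=
    ⟨B, hB, le_rfl, (finite_relQuot_iff _ _).2 ⟨⊥, inferInstance, le_sup_left⟩⟩
  obtain ⟨G, hG, hplus⟩ := (D.nhdSat_le hB_sat).2
  refine ⟨G ⊔ F, inferInstance, hAF.trans ?_⟩
  rw [← sup_assoc]
  exact sup_le_sup_right hplus F

theorem Gr.eq_of_le {L L' : D.Gr} (h : (L : Submodule k V) ≤ L') : L = L' := by
  obtain ⟨L, ⟨hL_inf, hL_sup⟩, hL_index⟩ := L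
  obtain ⟨L', ⟨hL'_inf, hL'_sup⟩, hL'_index⟩ := L'
  change L ≤ L' at h
  have hle_inf : L ⊓ D.plus ≤ L' ⊓ D.plus := inf_le_inf_right _ h
  have hle_sup : L ⊔ D.plus ≤ L' ⊔ D.plus := sup_le_sup_right h _
  have hfactor : Function.Surjective (Submodule.factor hle_sup) :=
    Submodule.factor_surjective hle_sup
  have hfinrank_inf := Submodule.finrank_mono hle_inf
  have hfinrank_sup := LinearMap.finrank_le_finrank_of_surjective hfactor
  simp only [index] at hL_index hL'_index
  have heq_inf : L ⊓ D.plus = L' ⊓ D.plus :=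
    Submodule.eq_of_le_of_finrank_eq hle_inf (by omega)
  have heq_sup : L ⊔ D.plus = L' ⊔ D.plus := by
    have hinj : Function.Injective (Submodule.factor hle_sup) :=
      (LinearMap.injective_iff_surjective_of_finrank_eq_finrank (by omega)).2 hfactor
    refine hle_sup.antisymm fun x hx => (Submodule.Quotient.mk_eq_zero _).1 (hinj ?_)
    exact ((Submodule.Quotient.mk_eq_zero _).2 hx).trans (map_zero _).symm
  exact Subtype.ext (eq_of_le_of_inf_le_of_sup_le h heq_inf.ge heq_sup.ge)

theorem exists_mem_nhd_disjoint_sup (L : D.Gr) (E : Submodule k V) [FiniteDimensional k E] :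
    ∃ B ∈ D.nhd, Disjoint ((L : Submodule k V) ⊔ E) B := by
  obtain ⟨A₀, ⟨⟨B₀, hB₀, hB₀A₀, -⟩, -⟩, hLA₀⟩ := D.exists_compl L
  have := finiteDimensional_sup_inf_of_disjoint (E := E) hLA₀.disjoint
  obtain ⟨B₁, hB₁, hdisj⟩ := D.exists_disjoint (((L : Submodule k V) ⊔ E) ⊓ A₀)
  refine ⟨B₀ ⊓ B₁, D.inf_mem _ hB₀ _ hB₁, disjoint_iff_inf_le.2 (hdisj ▸ ?_)⟩
  rw [← inf_assoc]
  exact inf_le_inf_right _ (inf_le_inf_left _ hB₀A₀)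

theorem mem_nhdZero_of_isCompl_of_le {L : D.Gr} {A B : Submodule k V}
    (hLA : IsCompl (L : Submodule k V) A) (hB : B ∈ D.nhd) (hBA : B ≤ A) : A ∈ D.nhdZero := by
  obtain ⟨A₀, ⟨hA₀, -⟩, hLA₀⟩ := D.exists_compl L
  obtain ⟨F, hF, hA₀F⟩ := exists_finiteDimensional_le_sup hA₀ hB
  have htop : A ≤ B ⊔ ((L : Submodule k V) ⊔ F) :=
    calc A ≤ (L : Submodule k V) ⊔ A₀ := hLA₀.sup_eq_top ▸ le_top
      _ ≤ (L : Submodule k V) ⊔ (B ⊔ F) := sup_le_sup_left hA₀F _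
      _ = B ⊔ ((L : Submodule k V) ⊔ F) := sup_left_comm _ _ _
  have hA_le : A ≤ B ⊔ ((L : Submodule k V) ⊔ F) ⊓ A :=
    (le_inf htop le_rfl).trans (sup_inf_assoc_of_le _ hBA).le
  have := finiteDimensional_sup_inf_of_disjoint (E := F) hLA.disjoint
  exact D.mem_nhdZero_of_isCompl L.2
    ⟨B, hB, hBA, (finite_relQuot_iff _ _).2 ⟨_, this, hA_le⟩⟩ hLA

theorem exists_isCompl_ge (L : D.Gr) {E : Submodule k V} [FiniteDimensional k E]
    (hLE : Disjoint (L : Submodule k V) E) :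
    ∃ A ∈ D.nhdZero, IsCompl (L : Submodule k V) A ∧ E ≤ A := by
  obtain ⟨B, hB, hdisj⟩ := exists_mem_nhd_disjoint_sup L E
  obtain ⟨A, hEBA, hAL⟩ :=
    (hLE.disjoint_sup_right_of_disjoint_sup_left hdisj).symm.exists_isCompl
  exact ⟨A, mem_nhdZero_of_isCompl_of_le hAL.symm hB (le_sup_right.trans hEBA), hAL.symm,
    le_sup_left.trans hEBA⟩

end Neighbourhoods

section Plucker

theorem sectionAt_eq_zero_of_not_disjoint {A : Submodule k V} (θ : D.RelFrame A) {L : D.Gr}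
    (h : ¬Disjoint (L : Submodule k V) A) : D.sectionAt θ L = 0 := by
  obtain ⟨x, hxLA, hx⟩ := Submodule.exists_mem_ne_zero_of_ne_bot (disjoint_iff.not.1 h)
  refine Subtype.ext (funext fun w => ?_)
  have := D.finite_range_sectionMap θ w
  refine fdet_eq_zero_of_apply_eq_zero (sectionMap θ w) (x := w.1.symm ⟨x, hxLA.1⟩) ?_ ?_
  · exact (LinearEquiv.map_ne_zero_iff _).2 fun h => hx (congrArg Subtype.val h)
  · simp [sectionMap, proj, (Submodule.mem_inf.1 hxLA).2]

theorem exists_evalAt_ne_zero {L : D.Gr} {E : Submodule k V} [FiniteDimensional k E]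
    (hLE : Disjoint (L : Submodule k V) E) : ∃ s : D.Omega, D.evalAt L s ≠ 0 ∧
      ∀ L' : D.Gr, ¬Disjoint (L' : Submodule k V) E → D.evalAt L' s = 0 := by
  obtain ⟨A, hA, hLA, hEA⟩ := exists_isCompl_ge L hLE
  obtain ⟨w⟩ := D.exists_frame L
  obtain ⟨θ, hθ⟩ := D.exists_relFrame hA hLA w
  refine ⟨⟨D.sectionAt θ, Submodule.subset_span ⟨A, hA, θ, rfl⟩⟩, fun h => ?_,
    fun L' hL'E => sectionAt_eq_zero_of_not_disjoint θ fun hL'A => hL'E (hL'A.mono_right hEA)⟩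
  have hfdet : fdet (sectionMap θ w) = 0 := congrFun (congrArg Subtype.val h) w
  rw [hθ, fdet_one] at hfdet
  exact one_ne_zero hfdet

theorem plucker_submodule (L : D.Gr) :
    (D.plucker L).submodule = (LinearMap.ker (D.evalAt L)).dualAnnihilator := by
  rw [plucker, Projectivization.submodule_mk'']
  exact LinearMap.range_dualMap_eq_dualAnnihilator_ker (V₁ := D.Omega)
    (V₂ := D.detDual (L : Submodule k V)) _

theorem plucker_injective : Function.Injective D.plucker := by
  intro L L' h
  have hann : (LinearMap.ker (D.evalAt L')).dualAnnihilator ≤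
      (LinearMap.ker (D.evalAt L)).dualAnnihilator := by
    rw [← plucker_submodule, ← plucker_submodule, h]
  have hker : LinearMap.ker (D.evalAt L) ≤ LinearMap.ker (D.evalAt L') :=
    (Subspace.dualAnnihilator_le_dualAnnihilator_iff (V := D.Omega)).1 hann
  refine Gr.eq_of_le fun x hxL => ?_
  by_contra hxL'
  have hx : x ≠ 0 := fun hx => hxL' (hx ▸ zero_mem _)
  obtain ⟨s, hs, hs_zero⟩ :=
    exists_evalAt_ne_zero ((Submodule.disjoint_span_singleton' hx).2 hxL')
  exact hs (hker (hs_zero L fun h => hx (Submodule.disjoint_span_singleton.1 h hxL)))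

theorem lieInALine_plucker_iff {L₁ L₂ L₃ : D.Gr} (h₁₂ : L₁ ≠ L₂) :
    LieInALine (D.plucker L₁) (D.plucker L₂) (D.plucker L₃) ↔
      LinearMap.ker (D.evalAt L₁) ⊓ LinearMap.ker (D.evalAt L₂) ≤ LinearMap.ker (D.evalAt L₃) :=
  lieInALine_iff_inf_le (plucker_injective.ne h₁₂) (plucker_submodule L₁) (plucker_submodule L₂)
    (plucker_submodule L₃)

end Plucker

section Collinear

variable {L₁ L₂ L₃ : D.Gr}

theorem disjoint_or_disjoint_of_lieInALine (h₁₂ : L₁ ≠ L₂)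
    (h : LieInALine (D.plucker L₁) (D.plucker L₂) (D.plucker L₃)) {E : Submodule k V}
    [FiniteDimensional k E] (hE : Disjoint (L₃ : Submodule k V) E) :
    Disjoint (L₁ : Submodule k V) E ∨ Disjoint (L₂ : Submodule k V) E := by
  by_contra! hE₁₂
  obtain ⟨s, hs₃, hs⟩ := exists_evalAt_ne_zero hE
  exact hs₃ ((lieInALine_plucker_iff h₁₂).1 h ⟨hs L₁ hE₁₂.1, hs L₂ hE₁₂.2⟩)

theorem inf_le_of_lieInALine (h₁₂ : L₁ ≠ L₂)
    (h : LieInALine (D.plucker L₁) (D.plucker L₂) (D.plucker L₃)) :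
    (L₁ : Submodule k V) ⊓ L₂ ≤ L₃ := by
  rintro x ⟨hx₁, hx₂⟩
  by_contra hx₃
  have hx : x ≠ 0 := fun hx => hx₃ (hx ▸ zero_mem _)
  rcases disjoint_or_disjoint_of_lieInALine h₁₂ h
    ((Submodule.disjoint_span_singleton' hx).2 hx₃) with hdisj | hdisj
  · exact hx (Submodule.disjoint_span_singleton.1 hdisj hx₁)
  · exact hx (Submodule.disjoint_span_singleton.1 hdisj hx₂)

theorem le_sup_span_singleton_of_lieInALine (h₁₂ : L₁ ≠ L₂)
    (h : LieInALine (D.plucker L₁) (D.plucker L₂) (D.plucker L₃)) {x : V}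
    (hx₁ : x ∈ (L₁ : Submodule k V)) (hx₃ : x ∉ (L₃ : Submodule k V)) :
    (L₂ : Submodule k V) ≤ (L₃ : Submodule k V) ⊔ Submodule.span k {x} := by
  intro y hy₂
  by_contra hy
  have hx0 : x ≠ 0 := fun hx => hx₃ (hx ▸ zero_mem _)
  have hy0 : y ≠ 0 := fun hy0 => hy (hy0 ▸ zero_mem _)
  have hdisj : Disjoint (L₃ : Submodule k V) (Submodule.span k {x} ⊔ Submodule.span k {y}) :=
    ((Submodule.disjoint_span_singleton' hx0).2 hx₃).disjoint_sup_right_of_disjoint_sup_left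
      ((Submodule.disjoint_span_singleton' hy0).2 hy)
  rcases disjoint_or_disjoint_of_lieInALine h₁₂ h hdisj with hdisj | hdisj
  · exact hx0 (Submodule.disjoint_span_singleton.1 (hdisj.mono_right le_sup_left) hx₁)
  · exact hy0 (Submodule.disjoint_span_singleton.1 (hdisj.mono_right le_sup_right) hy₂)

theorem covBy_sup_of_lieInALine (h₁₂ : L₁ ≠ L₂) (h₁₃ : L₁ ≠ L₃) (h₂₃ : L₂ ≠ L₃)
    (h : LieInALine (D.plucker L₁) (D.plucker L₂) (D.plucker L₃)) :
    (L₃ : Submodule k V) ⋖ L₁ ⊔ L₂ ⊔ L₃ := by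
  obtain ⟨x, hx₁, hx₃⟩ := SetLike.not_le_iff_exists.1 (mt Gr.eq_of_le h₁₃)
  obtain ⟨y, hy₂, hy₃⟩ := SetLike.not_le_iff_exists.1 (mt Gr.eq_of_le h₂₃)
  have hL₂ := le_sup_span_singleton_of_lieInALine h₁₂ h hx₁ hx₃
  have hL₁ : (L₁ : Submodule k V) ≤ (L₃ : Submodule k V) ⊔ Submodule.span k {x} :=
    (le_sup_span_singleton_of_lieInALine h₁₂.symm h.swap hy₂ hy₃).trans
      (sup_le le_sup_left ((Submodule.span_singleton_le_iff_mem _ _).2 (hL₂ hy₂)))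
  have hsup : (L₁ : Submodule k V) ⊔ L₂ ⊔ L₃ = Submodule.span k {x} ⊔ L₃ := by
    refine le_antisymm (sup_le (sup_le ?_ ?_) le_sup_right) (sup_le_sup_right ?_ _)
    · exact hL₁.trans (sup_comm _ _).le
    · exact hL₂.trans (sup_comm _ _).le
    · exact ((Submodule.span_singleton_le_iff_mem _ _).2 hx₁).trans le_sup_left
  exact hsup ▸ Submodule.covBy_span_singleton_sup hx₃

theorem covBy_of_lieInALine (h₁₂ : L₁ ≠ L₂) (h₁₃ : L₁ ≠ L₃) (h₂₃ : L₂ ≠ L₃)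
    (h : LieInALine (D.plucker L₁) (D.plucker L₂) (D.plucker L₃)) :
    (L₁ : Submodule k V) ⊓ L₂ ⋖ L₃ ∧ (L₃ : Submodule k V) ⋖ L₁ ⊔ L₂ := by
  set S : Submodule k V := L₁ ⊔ L₂ ⊔ L₃ with hS
  have hL₃ : (L₃ : Submodule k V) ⋖ S := covBy_sup_of_lieInALine h₁₂ h₁₃ h₂₃ h
  have hL₁ : (L₁ : Submodule k V) ⋖ S := by
    have hrot : (L₂ : Submodule k V) ⊔ L₃ ⊔ L₁ = S := by rw [hS]; ac_rfl
    exact hrot ▸ covBy_sup_of_lieInALine h₂₃ h₁₂.symm h₁₃.symm h.rotate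
  have hL₂ : (L₂ : Submodule k V) ⋖ S := by
    have hrot : (L₃ : Submodule k V) ⊔ L₁ ⊔ L₂ = S := by rw [hS]; ac_rfl
    exact hrot ▸ covBy_sup_of_lieInALine h₁₃.symm h₂₃.symm h₁₂ h.rotate.rotate
  have hne₁₂ : (L₁ : Submodule k V) ≠ L₂ := Subtype.coe_injective.ne h₁₂
  have hne₁₃ : (L₁ : Submodule k V) ≠ L₃ := Subtype.coe_injective.ne h₁₃
  have hsup : (L₁ : Submodule k V) ⊔ L₂ = S := hL₁.wcovBy.sup_eq hL₂.wcovBy hne₁₂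
  exact ⟨inf_covBy_of_inf_le hL₁ hL₂ hL₃ hne₁₂ hne₁₃ (inf_le_of_lieInALine h₁₂ h), hsup ▸ hL₃⟩

end Collinear

section Pencil

theorem Frame.exists_map {L L' : Submodule k V} (w : D.Frame L) (g : V →ₗ[k] V)
    [FiniteDimensional k (LinearMap.range (g - 1))] (hg : Disjoint L (LinearMap.ker g))
    (hL' : L.map g = L') : ∃ w' : D.Frame L', ∀ v, (w'.1 v : V) = g (w.1 v) := by
  let e : L ≃ₗ[k] L' :=
    LinearEquiv.ofInjective (g.domRestrict L) (LinearMap.injective_domRestrict_iff.2 hg) ≪≫ₗ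
      LinearEquiv.ofEq _ _ ((LinearMap.range_domRestrict L g).trans hL')
  have he : ∀ l, (e l : V) = g l := fun _ => rfl
  have hsplit : proj D.plus L' ∘ₗ (w.1 ≪≫ₗ e).toLinearMap - 1 =
      (proj D.plus L ∘ₗ w.1.toLinearMap - 1) +
        D.plus.mkQ ∘ₗ (g - 1) ∘ₗ L.subtype ∘ₗ w.1.toLinearMap := by
    refine LinearMap.ext fun v => ?_
    simp only [proj, LinearMap.sub_apply, LinearMap.comp_apply, LinearMap.add_apply,
      LinearEquiv.coe_coe, LinearEquiv.trans_apply, Submodule.subtype_apply, Module.End.one_apply,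
      he, map_sub]
    abel
  refine ⟨⟨w.1 ≪≫ₗ e, ?_⟩, fun v => he _⟩
  rw [hsplit]
  exact finite_range_add _ _ w.2
    (finite_range_comp_left _ _ (finite_range_comp_right _ _ inferInstance))

variable {I : Submodule k V} {x y : V}

theorem Frame.exists_sup_span_singleton {L L' : Submodule k V} (w : D.Frame L)
    {f : Module.Dual k V} (hI : I ≤ LinearMap.ker f) (hx : f x = 1) (hy : y ∉ I)
    (hL : I ⊔ Submodule.span k {x} = L) (hL' : I ⊔ Submodule.span k {y} = L') :
    ∃ w' : D.Frame L', ∀ v, (w'.1 v : V) = w.1 v + f (w.1 v) • (y - x) := by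
  subst hL hL'
  obtain ⟨w', hw'⟩ := w.exists_map (LinearMap.transvection f (y - x))
    (disjoint_ker_transvection hI hx hy) (map_transvection_sup_span_singleton hI hx)
  exact ⟨w', fun v => (hw' v).trans (LinearMap.transvection.apply _ _ _)⟩

theorem fdet_sectionMap_add {A L₁ L₂ L₃ : Submodule k V} (θ : D.RelFrame A) {w₁ : D.Frame L₁}
    {w₂ : D.Frame L₂} {w₃ : D.Frame L₃} {f : Module.Dual k V} (hxL : x ∈ L₁) (hx : f x = 1)
    (hw₂ : ∀ v, (w₂.1 v : V) = w₁.1 v + f (w₁.1 v) • (y - x))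
    (hw₃ : ∀ v, (w₃.1 v : V) = w₁.1 v + f (w₁.1 v) • (x + y - x)) :
    fdet (sectionMap θ w₃) = fdet (sectionMap θ w₁) + fdet (sectionMap θ w₂) := by
  have hfin₁ := D.finite_range_sectionMap θ w₁
  have hfin₂ := D.finite_range_sectionMap θ w₂
  have hfin₃ := D.finite_range_sectionMap θ w₃
  have hsection : ∀ {L : Submodule k V} (w : D.Frame L) (v : V ⧸ D.plus),
      sectionMap θ w v = θ.1 (A.mkQ (w.1 v)) := fun _ _ => rfl
  let φ : (V ⧸ D.plus) →ₗ[k] k := f ∘ₗ L₁.subtype ∘ₗ w₁.1.toLinearMap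
  have hφ : ∀ v, φ v = f (w₁.1 v) := fun _ => rfl
  refine fdet_add_of_eqOn_ker φ (p := w₁.1.symm ⟨x, hxL⟩) ?_ (fun v hv => ?_) (fun v hv => ?_) ?_
  · simp [hφ, hx]
  · rw [hsection, hsection, hw₃, ← hφ, hv, zero_smul, add_zero]
  · rw [hsection, hsection, hw₂, hw₃, ← hφ, hv, zero_smul, zero_smul]
  · rw [hsection, hsection, hsection, hw₂, hw₃, LinearEquiv.apply_symm_apply, ← map_add, ← map_add,
      hx, one_smul, one_smul, add_sub_cancel, add_sub_cancel]

theorem detDual_eq_zero_of_apply_eq_zero {L : Submodule k V} {s : D.detDual L} (w : D.Frame L)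
    (h : s.1 w = 0) : s = 0 :=
  Subtype.ext (funext fun w' => by rw [s.2 w w', h, mul_zero]; rfl)

variable {L₁ L₂ L₃ : D.Gr}

theorem exists_frames_apply_eq_add (hxI : x ∉ I) (hyI : y ∉ I) (hxyI : x + y ∉ I)
    (hL₁ : I ⊔ Submodule.span k {x} = L₁) (hL₂ : I ⊔ Submodule.span k {y} = L₂)
    (hL₃ : I ⊔ Submodule.span k {x + y} = L₃) :
    ∃ (w₁ : D.Frame (L₁ : Submodule k V)) (w₂ : D.Frame (L₂ : Submodule k V))
      (w₃ : D.Frame (L₃ : Submodule k V)), ∀ s ∈ D.Omega,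
        (s L₃).1 w₃ = (s L₁).1 w₁ + (s L₂).1 w₂ := by
  obtain ⟨f, hfx, hfI⟩ : ∃ f : Module.Dual k V, f x = 1 ∧ I ≤ LinearMap.ker f := by
    obtain ⟨f₀, hf₀x, hf₀I⟩ := Submodule.exists_le_ker_of_notMem hxI
    exact ⟨(f₀ x)⁻¹ • f₀, inv_mul_cancel₀ hf₀x,
      hf₀I.trans (LinearMap.ker_smul f₀ _ (inv_ne_zero hf₀x)).ge⟩
  have hxL₁ : x ∈ (L₁ : Submodule k V) :=
    hL₁ ▸ Submodule.mem_sup_right (Submodule.mem_span_singleton_self x)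
  obtain ⟨w₁⟩ := D.exists_frame L₁
  obtain ⟨w₂, hw₂⟩ := w₁.exists_sup_span_singleton hfI hfx hyI hL₁ hL₂
  obtain ⟨w₃, hw₃⟩ := w₁.exists_sup_span_singleton hfI hfx hxyI hL₁ hL₃
  refine ⟨w₁, w₂, w₃, fun s hs => ?_⟩
  induction hs using Submodule.span_induction with
  | mem s hs =>
    obtain ⟨A, -, θ, rfl⟩ := hs
    exact fdet_sectionMap_add θ hxL₁ hfx hw₂ hw₃
  | zero => exact (add_zero 0).symm
  | add s t _ _ hs ht => exact (congrArg₂ (· + ·) hs ht).trans (add_add_add_comm _ _ _ _)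
  | smul c s _ hs => exact (congrArg (c * ·) hs).trans (mul_add _ _ _)

theorem lieInALine_of_sup_span_singleton (h₁₂ : L₁ ≠ L₂) (hxI : x ∉ I) (hyI : y ∉ I)
    (hxyI : x + y ∉ I) (hL₁ : I ⊔ Submodule.span k {x} = L₁)
    (hL₂ : I ⊔ Submodule.span k {y} = L₂) (hL₃ : I ⊔ Submodule.span k {x + y} = L₃) :
    LieInALine (D.plucker L₁) (D.plucker L₂) (D.plucker L₃) := by
  obtain ⟨w₁, w₂, w₃, hw⟩ := exists_frames_apply_eq_add hxI hyI hxyI hL₁ hL₂ hL₃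
  refine (lieInALine_plucker_iff h₁₂).2 ?_
  rintro s ⟨hs₁, hs₂⟩
  have hs₁' : s.1 L₁ = 0 := hs₁
  have hs₂' : s.1 L₂ = 0 := hs₂
  refine detDual_eq_zero_of_apply_eq_zero w₃ ((hw s.1 s.2).trans ?_)
  rw [hs₁', hs₂']
  exact add_zero 0

theorem lieInALine_of_covBy (h₁₂ : L₁ ≠ L₂) (h₁₃ : L₁ ≠ L₃) (h₂₃ : L₂ ≠ L₃)
    (h_inf : (L₁ : Submodule k V) ⊓ L₂ ⋖ L₃) (h_sup : (L₃ : Submodule k V) ⋖ L₁ ⊔ L₂) :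
    LieInALine (D.plucker L₁) (D.plucker L₂) (D.plucker L₃) := by
  have hinf₁ : (L₁ : Submodule k V) ⊓ L₂ ⋖ L₁ :=
    inf_covBy_left_of_covBy h_inf h_sup (mt Gr.eq_of_le h₁₃) (mt Gr.eq_of_le h₁₃.symm)
  have hinf₂ : (L₁ : Submodule k V) ⊓ L₂ ⋖ L₂ := by
    rw [inf_comm] at h_inf ⊢
    rw [sup_comm] at h_sup
    exact inf_covBy_left_of_covBy h_inf h_sup (mt Gr.eq_of_le h₂₃) (mt Gr.eq_of_le h₂₃.symm)
  obtain ⟨z, hz₃, hz⟩ := SetLike.exists_of_lt h_inf.lt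
  obtain ⟨x, hx₁, y, hy₂, rfl⟩ := Submodule.mem_sup.1 (h_sup.le hz₃)
  have hL₃ := sup_span_singleton_eq_of_covBy h_inf hz₃ hz
  have hx₂ : x ∉ (L₂ : Submodule k V) := fun hx₂ => by
    refine h₂₃.symm (Gr.eq_of_le (hL₃ ▸ sup_le inf_le_right ?_))
    exact (Submodule.span_singleton_le_iff_mem _ _).2 (add_mem hx₂ hy₂)
  have hy₁ : y ∉ (L₁ : Submodule k V) := fun hy₁ => by
    refine h₁₃.symm (Gr.eq_of_le (hL₃ ▸ sup_le inf_le_left ?_))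
    exact (Submodule.span_singleton_le_iff_mem _ _).2 (add_mem hx₁ hy₁)
  have hxI : x ∉ (L₁ : Submodule k V) ⊓ L₂ := fun h => hx₂ h.2
  have hyI : y ∉ (L₁ : Submodule k V) ⊓ L₂ := fun h => hy₁ h.1
  exact lieInALine_of_sup_span_singleton h₁₂ hxI hyI hz
    (sup_span_singleton_eq_of_covBy hinf₁ hx₁ hxI) (sup_span_singleton_eq_of_covBy hinf₂ hy₂ hyI)
    hL₃

end Pencil

end GrassData

end InfGrass

open InfGrass InfGrass.GrassData in
theorem mainTheorem6 {k V : Type*} [Field k] [AddCommGroup V] [Module k V]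
    (D : InfGrass.GrassData k V) (L₁ L₂ L₃ : D.Gr)
    (h₁₂ : L₁ ≠ L₂) (h₁₃ : L₁ ≠ L₃) (h₂₃ : L₂ ≠ L₃) :
    InfGrass.LieInALine (D.plucker L₁) (D.plucker L₂) (D.plucker L₃) ↔
      InfGrass.LeOfCodimOne ((L₁ : Submodule k V) ⊓ L₂) (L₃ : Submodule k V) ∧
        InfGrass.LeOfCodimOne (L₃ : Submodule k V) ((L₁ : Submodule k V) ⊔ L₂) := by
  rw [leOfCodimOne_iff_covBy, leOfCodimOne_iff_covBy]
  exact ⟨covBy_of_lieInALine h₁₂ h₁₃ h₂₃,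
    fun ⟨h_inf, h_sup⟩ => lieInALine_of_covBy h₁₂ h₁₃ h₂₃ h_inf h_sup⟩
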